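/- Let $\Omega=C[0,1]$ with the uniform metric and its Borel sets, let $W$ be Wiener measure on $\Omega$, and let $t\in[0,1]$, used as an oracle through its binary expansion. For $S\subseteq\Omega$ write $S^1=S$, $S^0=\Omega\setminus S$, and let $O_\varepsilon(S)$ be the open $\varepsilon$-neighbourhood of $S$. For $n\ge1$ let $C_n$ be the set of continuous functions on $[0,1]$ that vanish at $0$ and are linear with slope $\pm\sqrt n$ on each $[(i-1)/n,i/n]$, $1\le i\le n$; such a function is coded by the binary string of its slopes' signs. A sequence $(F_i)_{i\in\mathbb N}$ of Borel subsets of $\Omega$ is a *$t$-effective generating sequence* if (1) $W(\overline G)=W(G)$ whenever $G$ is one of $F_i$, $F_i^0$, $O_\varepsilon(F_i)$, $O_\varepsilon(F_i^0)$ with $i\in\mathbb N$, $\varepsilon>0$; (2) there is a $t$-computable function that yields, for $i_1<\dots<i_n$ and $k\in\mathbb N$, a dyadic rational $\beta$ with $|W(F_{i_1}\cap\dots\cap F_{i_n})-\beta|<2^{-k}$; (3) for $x\in C_n$, rational $\varepsilon>0$ and $i\in\mathbb N$, the relations $x\in O_\varepsilon(F_i)$ and $x\in O_\varepsilon(F_i^0)$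 are decidable relative to $t$, uniformly in the code of $x$ and in $\varepsilon,i,n$. It is *non-atomic* if $W(\bigcap_i F_i^{b(i)})=0$ for every $b:\mathbb N\to\{0,1\}$. Let $\mathscr F=\{T_k:k\in\mathbb N\}$ be the Boolean algebra generated by $(F_i)$, enumerated by means of the codes $k$ of the finite Boolean combinations (in disjunctive normal form) of the $F_i$. A set $A\subseteq\Omega$ is *$t$-effectively $\mathscr F$-null* if there are a $t$-computable $f:\mathbb N^2\to\mathbb N$ and a computable $\psi:\mathbb N\to\mathbb N$ such that, with $U_n=\bigcup_m T_{f(n,m)}$, we have $A\subseteq\bigcap_n U_n$ and $W(U_n)\le2^{-k}$ whenever $n\ge\psi(k)$. The path $\omega$ is *$t$-$\mathscr F$-random* if it lies in no such set. Define $\Phi$ from $\mathscr F$ to the finite unions of half-open intervals $[a,b)\subseteq[0,1)$ in stages: $\Phi(\Omega)=[0,1)$; if $B$ is an atom of the Boolean algebra generated by the first $n$ sets of the sequence, $F$ is the next set of the sequence, and $\Phi(B)=[x,y)$, put $\Phi(B\cap F)=[x,x+W(B\cap F))$ and $\Phi(B\setminus F)=[x+W(B\cap F),y)$; extend $\Phi$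 to finite unions of atoms by taking unions. For $\omega\in\Omega$ let $\varphi(\omega)$ be the unique member of $\bigcap\{\Phi(T):T\in\mathscr F,\ \omega\in T\}$ if this set has exactly one member, and undefined otherwise. Let $\mathrm{RAND}^t\subseteq[0,1]$ be the set of numbers that are Martin-Löf random relative to $t$, i.e. that lie in no $\bigcap_nV_n$ where $(V_n)$ is a uniformly $\Sigma^0_1(t)$ sequence of open sets (each $V_n$ being the union of a sequence of open intervals with rational endpoints, $t$-computable uniformly in $n$) such that $V_n\cap[0,1]$ has Lebesgue measure at most $2^{-n}$. **Theorem.** Let $t\in[0,1]$, let $(F_i)$ be a non-atomic $t$-effective generating sequence, $\mathscr F$ its generated algebra, and $\omega\in\Omega$. The following are equivalent: (1) $\omega$ is $t$-$\mathscr F$-random; (2) $\varphi(\omega)$ is defined and $\varphi(\omega)\in\mathrm{RAND}^t$. -/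

import Mathlib

open MeasureTheory ProbabilityTheory
open scoped ENNReal

noncomputable section

namespace BrownianRandomness

/-! ### Path space and Wiener measure -/

/-- The space `Ω = C[0,1]` of continuous real functions on `[0,1]`, with the uniform metric. -/
abbrev PathSpace : Type := C(unitInterval, ℝ)

instance : MeasurableSpace PathSpace := borel PathSpace

instance : BorelSpace PathSpace := ⟨rfl⟩

/-- `W` is the Wiener measure on the Borel sets of `C[0,1]`: paths start at `0` almost surely,
increments over consecutive time intervals are independent, and `ω(t) - ω(s)` has law
`N(0, t - s)` for `s ≤ t`. These conditions determine `W` uniquely. -/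
structure IsWienerMeasure (W : Measure PathSpace) : Prop where
  isProbabilityMeasure : IsProbabilityMeasure W
  start : ∀ᵐ ω ∂W, ω 0 = 0
  indep : HasIndepIncrements (fun (s : unitInterval) (ω : PathSpace) => ω s) W
  law : ∀ s t : unitInterval, s ≤ t →
    HasLaw (fun ω : PathSpace => ω t - ω s) (gaussianReal 0 (Real.toNNReal ((t : ℝ) - s))) W

/-- The function in `C_n`, `n = a.length`, with code `a`: it vanishes at `0` and on
`[i/n, (i+1)/n]` it is linear with slope `√n` if the `i`-th letter of `a` is `true` and `-√n` if
it is `false`. -/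
def walk (a : List Bool) : PathSpace where
  toFun s := √(a.length : ℝ) * ∑ i : Fin a.length,
    (if a.get i then (1 : ℝ) else -1) *
      max 0 (min ((s : ℝ) - (i : ℝ) / a.length) (1 / a.length))
  continuous_toFun := by fun_prop

/-! ### Computability relative to a real -/

/-- The binary digits of `t ∈ [0,1]` after the binary point (`n = 0` is the first one). -/
def bit (t : unitInterval) (n : ℕ) : ℕ := ⌊(2 : ℝ) ^ (n + 1) * (t : ℝ)⌋₊ % 2

/-- The oracle given by `t ∈ [0,1]`: its binary expansion. -/
def oracle (t : unitInterval) : Set (ℕ →. ℕ) := {fun n => Part.some (bit t n)}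

/-- The rational number coded by `(p, q, r)`, namely `(p - q) / (r + 1)`. -/
def codedRat (c : ℕ × ℕ × ℕ) : ℚ := ((c.1 : ℚ) - c.2.1) / (c.2.2 + 1)

/-! ### Martin-Löf randomness relative to `t` -/

/-- The open set given by a sequence of (codes of) pairs of rational endpoints, the union of the
intervals between them. -/
def codedOpen (e : ℕ → (ℕ × ℕ × ℕ) × (ℕ × ℕ × ℕ)) : Set ℝ :=
  ⋃ m, Set.Ioo (codedRat (e m).1 : ℝ) (codedRat (e m).2)

/-- `U` is a Martin-Löf test on `[0,1]` relative to `t`: the sets `U n` are open, uniformly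
`Σ⁰₁` in `t`, and `U n` has Lebesgue measure at most `2⁻ⁿ` in `[0,1]`. -/
def IsMLTest (t : unitInterval) (U : ℕ → Set ℝ) : Prop :=
  ∃ e : ℕ → ℕ → (ℕ × ℕ × ℕ) × (ℕ × ℕ × ℕ), ComputableIn₂ (oracle t) e ∧
    (∀ n, U n = codedOpen (e n)) ∧
    ∀ n, volume (U n ∩ Set.Icc 0 1) ≤ (2 : ℝ≥0∞)⁻¹ ^ n

/-- `RAND^t`, the set of numbers in `[0,1]` that are Martin-Löf random relative to `t`. -/
def RAND (t : unitInterval) : Set ℝ :=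
  {x | x ∈ Set.Icc 0 1 ∧ ∀ U, IsMLTest t U → x ∉ ⋂ n, U n}

/-! ### Randomness with respect to an enumerated algebra of sets -/

/-- `A` is a `t`-effective null set for the enumerated family `T = {T_i : i ∈ ℕ}`. -/
def IsEffectiveNull {Ω : Type*} [MeasurableSpace Ω] (μ : Measure Ω) (t : unitInterval)
    (T : ℕ → Set Ω) (A : Set Ω) : Prop :=
  ∃ f : ℕ → ℕ → ℕ, ComputableIn₂ (oracle t) f ∧
    A ⊆ ⋂ n, ⋃ m, T (f n m) ∧
    ∃ ψ : ℕ → ℕ, Computable ψ ∧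
      ∀ k n, ψ k ≤ n → μ (⋃ m, T (f n m)) ≤ (2 : ℝ≥0∞)⁻¹ ^ k

/-- `ω` belongs to no `t`-effective null set for the enumerated family `T`. -/
def IsRandom {Ω : Type*} [MeasurableSpace Ω] (μ : Measure Ω) (t : unitInterval)
    (T : ℕ → Set Ω) (ω : Ω) : Prop :=
  ∀ A, IsEffectiveNull μ t T A → ω ∉ A

/-- `signed F i true = F i` and `signed F i false` is the complement of `F i`. -/
def signed {Ω : Type*} (F : ℕ → Set Ω) (i : ℕ) (b : Bool) : Set Ω :=
  if b then F i else (F i)ᶜ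

/-- The Boolean combination of the sets `F i` in disjunctive normal form given by `c`. -/
def evalDNF {Ω : Type*} (F : ℕ → Set Ω) (c : List (List (ℕ × Bool))) : Set Ω :=
  ⋃ d ∈ c, ⋂ l ∈ d, signed F l.1 l.2

/-- The effective enumeration of the Boolean algebra generated by `F`: the `k`-th
element is the Boolean combination with code `k`. -/
def generatedAlgebra {Ω : Type*} (F : ℕ → Set Ω) (k : ℕ) : Set Ω :=
  (Encodable.decode (α := List (List (ℕ × Bool))) k).elim ∅ (evalDNF F)

/-- `F` is non-atomic: `⋂ k, F_k^{b(k)}` is null for each `b : ℕ → {0,1}`. -/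
def IsNonAtomic {Ω : Type*} [MeasurableSpace Ω] (μ : Measure Ω) (F : ℕ → Set Ω) : Prop :=
  ∀ b : ℕ → Bool, μ (⋂ k, signed F k (b k)) = 0

/-- `F` is a `t`-effective generating sequence of Borel sets of `C[0,1]`.
In `approx`, the dyadic rational `(β (l, k)).1 / 2 ^ (β (l, k)).2` approximates the measure of the
intersection of the `F i`, `i ∈ l`. In `recursive_thickening`, `ε` is the positive rational
`(p + 1) / (q + 1)` and `x ∈ C_n`, `n ≥ 1`, is given by its code. -/
structure IsEffectiveGeneratingSequence (W : Measure PathSpace) (t : unitInterval)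
    (F : ℕ → Set PathSpace) : Prop where
  measurableSet : ∀ i, MeasurableSet (F i)
  measure_closure : ∀ i b, W (closure (signed F i b)) = W (signed F i b)
  measure_closure_thickening : ∀ i b, ∀ ε : ℝ, 0 < ε →
    W (closure (Metric.thickening ε (signed F i b))) = W (Metric.thickening ε (signed F i b))
  approx : ∃ β : List ℕ × ℕ → ℕ × ℕ, ComputableIn (oracle t) β ∧
    ∀ (l : List ℕ) (k : ℕ), l.Pairwise (· < ·) →
      |W.real (⋂ i ∈ l, F i) - ((β (l, k)).1 : ℝ) / 2 ^ (β (l, k)).2| < (1 / 2 : ℝ) ^ k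
  recursive_thickening : ∀ b : Bool, ∃ d : List Bool × ℕ × ℕ × ℕ → Bool,
    ComputableIn (oracle t) d ∧
      ∀ (a : List Bool) (p q i : ℕ), a ≠ [] →
        (d (a, p, q, i) = true ↔
          walk a ∈ Metric.thickening (((p : ℝ) + 1) / (q + 1)) (signed F i b))

/-! ### The Wiener–Carathéodory homomorphism and the induced point map -/

/-- The atoms of the Boolean algebra generated by `F 0, …, F (n - 1)` (some may be empty).
A list `b_{n-1}, …, b_0` (the last choice comes first) gives `⋂ i < n, F_i^{b_i}`. -/
def atom {Ω : Type*} (F : ℕ → Set Ω) : List Bool → Set Ω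
  | [] => Set.univ
  | b :: σ => atom F σ ∩ signed F σ.length b

/-- The left endpoint of the interval assigned to an atom. Passing from `n` to `n + 1`
generators, the interval of an atom `B` is cut into a left part of length `μ (B ∩ F n)`, assigned
to `B ∩ F n`, and the remaining right part, assigned to `B \ F n`. -/
def leftEnd {Ω : Type*} [MeasurableSpace Ω] (μ : Measure Ω) (F : ℕ → Set Ω) : List Bool → ℝ
  | [] => 0
  | true :: σ => leftEnd μ F σ
  | false :: σ => leftEnd μ F σ + μ.real (atom F (true :: σ))

/-- The half-open interval, of length the measure of the atom, assigned to an atom. -/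
def atomInterval {Ω : Type*} [MeasurableSpace Ω] (μ : Measure Ω) (F : ℕ → Set Ω)
    (σ : List Bool) : Set ℝ :=
  Set.Ico (leftEnd μ F σ) (leftEnd μ F σ + μ.real (atom F σ))

/-- The homomorphism `Φ` from the Boolean algebra generated by `F` to the finite unions of
half-open intervals: `Φ T` is the union of the intervals of the atoms contained in `T`.
(If `T` lies in the algebra generated by `F 0, …, F (n - 1)`, the atoms of that algebra suffice:
the interval of an atom is the union of the intervals of the two atoms into which it
splits, and empty atoms have empty intervals.) -/
def wcHom {Ω : Type*} [MeasurableSpace Ω] (μ : Measure Ω) (F : ℕ → Set Ω) (T : Set Ω) : Set ℝ :=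
  ⋃ (σ : List Bool) (_ : atom F σ ⊆ T), atomInterval μ F σ

/-- The set `⋂ {Φ T : ω ∈ T}`, `T` ranging over the algebra generated by `F`. -/
def wcFiber {Ω : Type*} [MeasurableSpace Ω] (μ : Measure Ω) (F : ℕ → Set Ω) (ω : Ω) : Set ℝ :=
  ⋂ (k : ℕ) (_ : ω ∈ generatedAlgebra F k), wcHom μ F (generatedAlgebra F k)

/-- The partial map `φ` induced by `Φ`: `φ ω` is the unique member of `⋂ {Φ T : ω ∈ T}`, if there
is exactly one. -/
def wcPoint {Ω : Type*} [MeasurableSpace Ω] (μ : Measure Ω) (F : ℕ → Set Ω) : Ω →. ℝ :=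
  fun ω => ⟨∃ x, wcFiber μ F ω = {x}, fun h => h.choose⟩

end BrownianRandomness

end

/-!
The map `Φ` carries the atoms of the algebra generated by `F 0, …, F (n - 1)` to consecutive
half-open intervals of the same measure, compatibly for all `n`. Encoding an atom by a binary
string, with the last choice first, extension of strings is the relation `τ <:+ σ`, and two strings
that are not comparable have disjoint atoms and disjoint intervals. Restricting to minimal strings
shows that an arbitrary union of atoms has the same measure as the union of their intervals
(`volume_iUnion_atomInterval`). By non-atomicity the intervals around a path `ω` shrink to a point
`x`, and `φ ω` is defined, with value `x`, as soon as `x` lies in all of them (`wcFiber_eq`,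
`exists_tendsto_endpoints`).

By inclusion–exclusion the endpoints of the intervals are signed sums of measures of intersections
of the `F i`, hence computable relative to `t`, uniformly in the string. So strict inequalities
between endpoints and rationals are semidecidable relative to `t`, and tests can be transferred in
both directions. A Martin-Löf test is pulled back to the atoms whose closed intervals lie inside a
rational interval of the test (`exists_isEffectiveNull_of_isMLTest`); an effectively null set is
pushed forward to the rational intervals strictly inside the intervals of the atoms contained in
its covering sets (`exists_isMLTest_of_isEffectiveNull`). Both constructions ignore the endpoints,
which is harmless: they are computable relative to `t`, and such numbers are not random relative
to `t` (`termsVal_notMem_RAND`). The same fact shows that `x` lies in all the intervals around `ω`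
when `x` is random, the only way to fail being that `x` is a right endpoint.

Neither argument uses the structure of path space: `isRandom_iff_wcPoint_mem_RAND` states the
equivalence for an arbitrary probability space.

Computability relative to an oracle is reduced to primitive recursion: the oracle is consulted only
by mapping a relatively computable function over a list (`ComputableIn.list_map`), and everything
done with the resulting values is primitive recursive.
-/

/-! ### Relative computability -/

section RelativeComputability

variable {α β γ σ : Type*} [Primcodable α] [Primcodable β] [Primcodable γ] [Primcodable σ]
  {O : Set (ℕ →. ℕ)}

theorem ComputableIn.comp {f : β → σ} {g : α → β} (hf : ComputableIn O f)
    (hg : ComputableIn O g) : ComputableIn O fun a => f (g a) := by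
  refine (Nat.RecursiveIn.comp hf hg).of_eq fun n => ?_
  rcases e : Encodable.decode (α := α) n with - | a <;> simp [Encodable.encodek]

theorem ComputableIn.pair {f : α → β} {g : α → γ} (hf : ComputableIn O f)
    (hg : ComputableIn O g) : ComputableIn O fun a => (f a, g a) := by
  refine (Nat.RecursiveIn.pair hf hg).of_eq fun n => ?_
  rcases e : Encodable.decode (α := α) n with - | a <;> simp [Seq.seq]

theorem ComputableIn₂.comp {f : β → γ → σ} {g : α → β} {h : α → γ} (hf : ComputableIn₂ O f)
    (hg : ComputableIn O g) (hh : ComputableIn O h) : ComputableIn O fun a => f (g a) (h a) :=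
  ComputableIn.comp (f := fun p : β × γ => f p.1 p.2) (g := fun a => (g a, h a)) hf (hg.pair hh)

theorem ComputableIn.nat_rec {f : α → ℕ} {g : α → σ} {h : α × ℕ × σ → σ}
    (hf : ComputableIn O f) (hg : ComputableIn O g) (hh : ComputableIn O h) :
    ComputableIn O fun a =>
      Nat.rec (motive := fun _ => σ) (g a) (fun y IH => h (a, y, IH)) (f a) := by
  have hid : Nat.RecursiveIn O (fun n => Part.some n) :=
    Nat.Partrec.recursiveIn Nat.Partrec.some
  refine ((Nat.RecursiveIn.prec hg hh).comp (Nat.RecursiveIn.pair hid hf)).of_eq fun n => ?_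
  rcases e : Encodable.decode (α := α) n with - | a
  · simp [Seq.seq]
  · simp only [Seq.seq, Part.map_eq_map, Part.map_some, Part.coe_some, Part.bind_some, e,
      Part.bind_eq_bind, Nat.unpair_pair]
    induction f a <;> simp_all [Encodable.encodek]

/-- The initial segments of a relatively computable sequence are relatively computable. -/
theorem ComputableIn.list_map_range {b : ℕ → σ} (hb : ComputableIn O b) :
    ComputableIn O fun n => (List.range n).map b := by
  have hstep : ComputableIn O fun p : ℕ × ℕ × List σ => p.2.2 ++ [b p.2.1] :=
    Primrec.list_concat.computableIn₂.comp (Primrec.snd.comp Primrec.snd).computableIn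
      (hb.comp (Primrec.fst.comp Primrec.snd).computableIn)
  have h := ComputableIn.nat_rec (α := ℕ) ComputableIn.id (ComputableIn.const ([] : List σ)) hstep
  have e : ∀ n : ℕ, Nat.rec (motive := fun _ => List σ) []
      (fun y IH => IH ++ [b y]) n = (List.range n).map b := by
    intro n
    induction n with
    | zero => rfl
    | succ n ih => simp [List.range_succ, ih]
  simpa only [e, id] using h

/-- Mapping a relatively computable function over a list is relatively computable: one computes
the values at all codes up to a common bound and looks them up. -/
theorem ComputableIn.list_map [Inhabited α] [Inhabited σ] {b : α → σ} (hb : ComputableIn O b) :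
    ComputableIn O fun l : List α => l.map b := by
  have hb' : ComputableIn O fun n : ℕ => b ((Encodable.decode (α := α) n).getD default) :=
    hb.comp (Primrec.option_getD_default.comp Primrec.decode).computableIn
  have hbound : Primrec fun l : List α =>
      l.foldr (fun a s => max (Encodable.encode a + 1) s) 0 :=
    Primrec.list_foldr Primrec.id (Primrec.const 0)
      (Primrec.nat_max.comp
        (Primrec.succ.comp (Primrec.encode.comp (Primrec.fst.comp Primrec.snd)))
        (Primrec.snd.comp Primrec.snd)).to₂
  have hlook : Primrec fun p : List α × List σ =>
      p.1.map fun a => p.2.getD (Encodable.encode a) default :=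
    Primrec.list_map Primrec.fst
      ((Primrec.list_getD default).comp (Primrec.snd.comp Primrec.fst)
        (Primrec.encode.comp Primrec.snd)).to₂
  have h := hlook.computableIn.comp
    (ComputableIn.id.pair (hb'.list_map_range.comp hbound.computableIn))
  have e : (fun l : List α => l.map b) = fun l : List α => l.map fun a =>
      ((List.range (l.foldr (fun a s => max (Encodable.encode a + 1) s) 0)).map fun n : ℕ =>
        b ((Encodable.decode (α := α) n).getD default)).getD (Encodable.encode a) default := by
    funext l
    refine List.map_congr_left fun a ha => ?_
    have hlt : Encodable.encode a < l.foldr (fun a s => max (Encodable.encode a + 1) s) 0 := by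
      induction l with
      | nil => simp at ha
      | cons c l ih =>
        rcases List.mem_cons.1 ha with rfl | h'
        · simp
        · simp [ih h']
    simp [List.getD_eq_getElem?_getD, hlt, Encodable.encodek]
  rw [e]
  exact h

theorem Primrec.nat_pow : Primrec₂ ((· ^ ·) : ℕ → ℕ → ℕ) :=
  Primrec₂.unpaired'.1 Nat.Primrec.pow

theorem Primrec.decode_getD [Inhabited α] :
    Primrec fun n => (Encodable.decode (α := α) n).getD default :=
  Primrec.option_getD_default.comp Primrec.decode

end RelativeComputability

namespace BrownianRandomness

/-! ### Comparing approximated reals with rationals -/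

/-- The numbers `s.1 - s.2`, understood as an approximation of `2 ^ k * r` with error at most
`2 * n`, witness that the rational coded by `c` is less than `r`. -/
def Below (c : ℕ × ℕ × ℕ) (s : ℕ × ℕ) (n k : ℕ) : Prop :=
  c.1 * 2 ^ k + (c.2.2 + 1) * (s.2 + 2 * n) < c.2.1 * 2 ^ k + (c.2.2 + 1) * s.1

instance (c : ℕ × ℕ × ℕ) (s : ℕ × ℕ) (n k : ℕ) : Decidable (Below c s n k) :=
  inferInstanceAs (Decidable (_ < _))

theorem primrecPred_below {α : Type*} [Primcodable α] {c : α → ℕ × ℕ × ℕ} {s : α → ℕ × ℕ}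
    {n k : α → ℕ} (hc : Primrec c) (hs : Primrec s) (hn : Primrec n) (hk : Primrec k) :
    PrimrecPred fun a => Below (c a) (s a) (n a) (k a) := by
  have h2 : Primrec fun a => 2 ^ k a := Primrec.nat_pow.comp (Primrec.const 2) hk
  have hd : Primrec fun a => (c a).2.2 + 1 :=
    Primrec.succ.comp (Primrec.snd.comp (Primrec.snd.comp hc))
  have he : Primrec fun a => (s a).2 + 2 * n a :=
    Primrec.nat_add.comp (Primrec.snd.comp hs) (Primrec.nat_mul.comp (Primrec.const 2) hn)
  exact Primrec.nat_lt.comp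
    (Primrec.nat_add.comp (Primrec.nat_mul.comp (Primrec.fst.comp hc) h2)
      (Primrec.nat_mul.comp hd he))
    (Primrec.nat_add.comp
      (Primrec.nat_mul.comp (Primrec.fst.comp (Primrec.snd.comp hc)) h2)
      (Primrec.nat_mul.comp hd (Primrec.fst.comp hs)))

theorem below_iff {c : ℕ × ℕ × ℕ} {s : ℕ × ℕ} {n k : ℕ} :
    Below c s n k ↔
      2 ^ k * (codedRat c : ℝ) + 2 * n < (s.1 : ℝ) - s.2 := by
  have hpos : (0 : ℝ) < c.2.2 + 1 := by positivity
  have e : ((codedRat c : ℚ) : ℝ) = ((c.1 : ℝ) - c.2.1) / (c.2.2 + 1) := by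
    simp [codedRat]
  have e' : (2 : ℝ) ^ k * (((c.1 : ℝ) - c.2.1) / (c.2.2 + 1)) + 2 * n
      = ((c.1 - c.2.1) * 2 ^ k + (c.2.2 + 1) * (2 * n)) / (c.2.2 + 1) := by
    field_simp
  rw [e, e', div_lt_iff₀ hpos, Below, ← Nat.cast_lt (α := ℝ)]
  push_cast
  constructor <;> intro h <;> linarith

theorem codedRat_lt_of_below {c : ℕ × ℕ × ℕ} {s : ℕ × ℕ} {n k : ℕ} {r : ℝ}
    (h : |2 ^ k * r - ((s.1 : ℝ) - s.2)| ≤ 2 * n) (hb : Below c s n k) : (codedRat c : ℝ) < r := by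
  rw [below_iff] at hb
  have h1 := (abs_le.1 h).1
  have h2 : (0 : ℝ) < 2 ^ k := by positivity
  exact lt_of_mul_lt_mul_left (by linarith) h2.le

theorem eventually_below {c : ℕ × ℕ × ℕ} {s : ℕ → ℕ × ℕ} {n : ℕ} {r : ℝ}
    (h : ∀ k, |2 ^ k * r - (((s k).1 : ℝ) - (s k).2)| ≤ 2 * n) (hc : (codedRat c : ℝ) < r) :
    ∀ᶠ k in Filter.atTop, Below c (s k) n k := by
  have ht : Filter.Tendsto (fun k : ℕ => (2 : ℝ) ^ k * (r - codedRat c)) Filter.atTop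
      Filter.atTop :=
    (tendsto_pow_atTop_atTop_of_one_lt one_lt_two).atTop_mul_const (sub_pos.2 hc)
  filter_upwards [ht.eventually_gt_atTop (4 * (n : ℝ))] with k hk
  rw [below_iff]
  have h1 := (abs_le.1 (h k)).2
  linarith

/-- The code of the opposite rational. -/
def negCode (c : ℕ × ℕ × ℕ) : ℕ × ℕ × ℕ := (c.2.1, c.1, c.2.2)

theorem primrec_negCode : Primrec negCode :=
  (Primrec.fst.comp Primrec.snd).pair (Primrec.fst.pair (Primrec.snd.comp Primrec.snd))

theorem primrec_swap {α β : Type*} [Primcodable α] [Primcodable β] :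
    Primrec (Prod.swap : α × β → β × α) :=
  Primrec.snd.pair Primrec.fst

theorem codedRat_negCode (c : ℕ × ℕ × ℕ) : codedRat (negCode c) = -codedRat c := by
  simp only [codedRat, negCode]
  ring

theorem lt_codedRat_of_below {c : ℕ × ℕ × ℕ} {s : ℕ × ℕ} {n k : ℕ} {r : ℝ}
    (h : |2 ^ k * r - ((s.1 : ℝ) - s.2)| ≤ 2 * n) (hb : Below (negCode c) s.swap n k) :
    r < (codedRat c : ℝ) := by
  have := codedRat_lt_of_below (r := -r) (by
    rw [← abs_neg]
    convert h using 2
    simp only [Prod.fst_swap, Prod.snd_swap]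
    ring) hb
  rw [codedRat_negCode] at this
  push_cast at this
  linarith

theorem eventually_below_swap {c : ℕ × ℕ × ℕ} {s : ℕ → ℕ × ℕ} {n : ℕ} {r : ℝ}
    (h : ∀ k, |2 ^ k * r - (((s k).1 : ℝ) - (s k).2)| ≤ 2 * n) (hc : r < (codedRat c : ℝ)) :
    ∀ᶠ k in Filter.atTop, Below (negCode c) (s k).swap n k := by
  refine eventually_below (r := -r) (s := fun k => (s k).swap) (fun k => ?_) ?_
  · rw [← abs_neg]
    convert h k using 2
    simp only [Prod.fst_swap, Prod.snd_swap]
    ring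
  · rw [codedRat_negCode]
    push_cast
    linarith

theorem exists_codedRat_eq (q : ℚ) : ∃ c, codedRat c = q := by
  refine ⟨(q.num.toNat, (-q.num).toNat, q.den - 1), ?_⟩
  have hd : ((q.den - 1 : ℕ) : ℚ) + 1 = q.den := by
    exact_mod_cast congrArg (Nat.cast (R := ℚ)) (Nat.succ_pred_eq_of_pos q.den_pos)
  have hn : ((q.num.toNat : ℕ) : ℚ) - ((-q.num).toNat : ℕ) = q.num := by
    have : ((q.num.toNat : ℕ) : ℤ) - ((-q.num).toNat : ℕ) = q.num := by omega
    exact_mod_cast this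
  simp only [codedRat]
  rw [hd, hn, Rat.num_div_den]

/-! ### Signed sums of measures of intersections -/

/-- The sums of the entries with positive sign (`true`) and of those with negative sign. -/
def signedSum (v : List (Bool × ℕ)) : ℕ × ℕ :=
  v.foldr (fun x s => bif x.1 then (s.1 + x.2, s.2) else (s.1, s.2 + x.2)) (0, 0)

theorem primrec_signedSum : Primrec signedSum := by
  have hs : Primrec fun p : List (Bool × ℕ) × (Bool × ℕ) × ℕ × ℕ => p.2.2 :=
    Primrec.snd.comp Primrec.snd
  have hx : Primrec fun p : List (Bool × ℕ) × (Bool × ℕ) × ℕ × ℕ => p.2.1 :=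
    Primrec.fst.comp Primrec.snd
  exact Primrec.list_foldr Primrec.id (Primrec.const (0, 0))
    (Primrec.cond (Primrec.fst.comp hx)
      (Primrec.pair (Primrec.nat_add.comp (Primrec.fst.comp hs) (Primrec.snd.comp hx))
        (Primrec.snd.comp hs))
      (Primrec.pair (Primrec.fst.comp hs)
        (Primrec.nat_add.comp (Primrec.snd.comp hs) (Primrec.snd.comp hx)))).to₂

/-- The value of a list of signed intersections: the sum of `± μ (⋂ i ∈ l, F i)` over its
entries `(±, l)`, where `true` stands for `+`. -/
noncomputable def termsVal {Ω : Type*} [MeasurableSpace Ω] (μ : Measure Ω) (F : ℕ → Set Ω)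
    (L : List (Bool × List ℕ)) : ℝ :=
  (L.map fun x => (if x.1 then 1 else -1) * μ.real (⋂ i ∈ x.2, F i)).sum

/-- `b` approximates the measures of the intersections: `b (l, k)` is within `2` of
`2 ^ k * μ (⋂ i ∈ l, F i)`. -/
def IsApprox {Ω : Type*} [MeasurableSpace Ω] (μ : Measure Ω) (F : ℕ → Set Ω)
    (b : List ℕ × ℕ → ℕ) : Prop :=
  ∀ (l : List ℕ) (k : ℕ), l.Pairwise (· < ·) →
    |2 ^ k * μ.real (⋂ i ∈ l, F i) - (b (l, k) : ℝ)| ≤ 2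

/-- Dyadic approximations can be brought to the denominator `2 ^ k`. -/
theorem exists_isApprox {Ω : Type*} [MeasurableSpace Ω] {μ : Measure Ω} {F : ℕ → Set Ω}
    {O : Set (ℕ →. ℕ)} {β : List ℕ × ℕ → ℕ × ℕ} (hβ : ComputableIn O β)
    (h : ∀ (l : List ℕ) (k : ℕ), l.Pairwise (· < ·) →
      |μ.real (⋂ i ∈ l, F i) - ((β (l, k)).1 : ℝ) / 2 ^ (β (l, k)).2| < (1 / 2 : ℝ) ^ k) :
    ∃ b, ComputableIn O b ∧ IsApprox μ F b := by
  refine ⟨fun p => (β p).1 * 2 ^ p.2 / 2 ^ (β p).2, ?_, fun l k hl => ?_⟩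
  · have hP : Primrec fun q : (List ℕ × ℕ) × ℕ × ℕ => q.2.1 * 2 ^ q.1.2 / 2 ^ q.2.2 :=
      Primrec.nat_div.comp
        (Primrec.nat_mul.comp (Primrec.fst.comp Primrec.snd)
          (Primrec.nat_pow.comp (Primrec.const 2) (Primrec.snd.comp Primrec.fst)))
        (Primrec.nat_pow.comp (Primrec.const 2) (Primrec.snd.comp Primrec.snd))
    exact hP.computableIn.comp (ComputableIn.id.pair hβ)
  · have h1 := h l k hl
    set m := μ.real (⋂ i ∈ l, F i)
    simp only
    generalize β (l, k) = y at h1 ⊢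
    obtain ⟨p, e⟩ := y
    simp only at h1 ⊢
    have hk : (0 : ℝ) < 2 ^ k := by positivity
    have h2 : |2 ^ k * m - (p : ℝ) * 2 ^ k / 2 ^ e| < 1 := by
      have : (2 : ℝ) ^ k * m - (p : ℝ) * 2 ^ k / 2 ^ e = 2 ^ k * (m - p / 2 ^ e) := by ring
      rw [this, abs_mul, abs_of_pos hk]
      calc (2 : ℝ) ^ k * |m - p / 2 ^ e| < 2 ^ k * (1 / 2) ^ k := mul_lt_mul_of_pos_left h1 hk
        _ = 1 := by rw [← mul_pow]; norm_num
    have h3 : ((p * 2 ^ k / 2 ^ e : ℕ) : ℝ) ≤ (p : ℝ) * 2 ^ k / 2 ^ e := by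
      simpa using Nat.cast_div_le (α := ℝ) (m := p * 2 ^ k) (n := 2 ^ e)
    have h4 : (p : ℝ) * 2 ^ k / 2 ^ e < ((p * 2 ^ k / 2 ^ e : ℕ) : ℝ) + 1 := by
      rw [div_lt_iff₀ (by positivity)]
      rw [mul_comm (_ + 1)]
      exact_mod_cast Nat.lt_mul_div_succ (p * 2 ^ k) (pow_pos two_pos e)
    rw [abs_lt] at h2
    rw [abs_le]
    constructor <;> linarith

/-- The approximation of `2 ^ k * termsVal μ F L` computed from `b`. -/
def approxTerms (b : List ℕ × ℕ → ℕ) (L : List (Bool × List ℕ)) (k : ℕ) : ℕ × ℕ :=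
  signedSum ((L.map fun x => (x, k)).map fun y => (y.1.1, b (y.1.2, y.2)))

theorem computableIn_approxTerms {O : Set (ℕ →. ℕ)} {b : List ℕ × ℕ → ℕ}
    (hb : ComputableIn O b) : ComputableIn₂ O (approxTerms b) := by
  have hin : Primrec fun p : List (Bool × List ℕ) × ℕ => p.1.map fun x => (x, p.2) :=
    Primrec.list_map Primrec.fst (Primrec.pair Primrec.snd (Primrec.snd.comp Primrec.fst)).to₂
  have hfun : ComputableIn O fun y : (Bool × List ℕ) × ℕ => (y.1.1, b (y.1.2, y.2)) :=
    (Primrec.fst.comp Primrec.fst).computableIn.pair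
      (hb.comp ((Primrec.snd.comp Primrec.fst).pair Primrec.snd).computableIn)
  exact primrec_signedSum.computableIn.comp (hfun.list_map.comp hin.computableIn)

theorem abs_sub_approxTerms_le {Ω : Type*} [MeasurableSpace Ω] {μ : Measure Ω} {F : ℕ → Set Ω}
    {b : List ℕ × ℕ → ℕ} (hb : IsApprox μ F b) {L : List (Bool × List ℕ)}
    (hL : ∀ x ∈ L, x.2.Pairwise (· < ·)) (k : ℕ) :
    |2 ^ k * termsVal μ F L - (((approxTerms b L k).1 : ℝ) - (approxTerms b L k).2)|
      ≤ 2 * L.length := by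
  induction L with
  | nil => simp [termsVal, approxTerms, signedSum]
  | cons x L ih =>
    obtain ⟨s, l⟩ := x
    have h1 := abs_le.1 (ih fun x hx => hL x (List.mem_cons_of_mem _ hx))
    have h2 := abs_le.1 (hb l k (hL _ List.mem_cons_self))
    have hv : termsVal μ F ((s, l) :: L) =
        (if s then 1 else -1) * μ.real (⋂ i ∈ l, F i) + termsVal μ F L := rfl
    have ha : approxTerms b ((s, l) :: L) k =
        bif s then ((approxTerms b L k).1 + b (l, k), (approxTerms b L k).2)
        else ((approxTerms b L k).1, (approxTerms b L k).2 + b (l, k)) := rfl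
    rw [abs_le, hv, ha, List.length_cons, mul_add]
    cases s <;>
    · simp only [cond_true, cond_false, if_true, Bool.false_eq_true, if_false]
      push_cast
      constructor <;> linarith

/-! ### Strings and atoms -/

section Strings

variable {Ω : Type*} {F : ℕ → Set Ω}

theorem append_singleton_suffix {α : Type*} {l m : List α} (h : l <:+ m) (a : α) :
    l ++ [a] <:+ m ++ [a] := by
  obtain ⟨t, rfl⟩ := h
  exact ⟨t, by simp⟩

/-- Two binary strings are comparable, or they disagree after a common beginning. -/
theorem suffix_or_suffix_or_branch (σ τ : List Bool) :
    σ <:+ τ ∨ τ <:+ σ ∨ ∃ ρ b, b :: ρ <:+ σ ∧ (!b) :: ρ <:+ τ := by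
  induction σ using List.reverseRecOn generalizing τ with
  | nil => exact Or.inl List.nil_suffix
  | append_singleton σ a ih =>
    rcases List.eq_nil_or_concat τ with rfl | ⟨τ, c, rfl⟩
    · exact Or.inr (Or.inl List.nil_suffix)
    · by_cases hac : a = c
      · subst hac
        rcases ih τ with h | h | ⟨ρ, b, h1, h2⟩
        · exact Or.inl (by simpa using append_singleton_suffix h a)
        · exact Or.inr (Or.inl (by simpa using append_singleton_suffix h a))
        · exact Or.inr (Or.inr ⟨ρ ++ [a], b, by simpa using append_singleton_suffix h1 a,
            by simpa using append_singleton_suffix h2 a⟩)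
      · refine Or.inr (Or.inr ⟨[], a, by simp, ?_⟩)
        have : (!a) = c := by cases a <;> cases c <;> simp_all
        rw [this]
        simp

theorem exists_minimal_suffix {S : Set (List Bool)} {σ : List Bool} (hσ : σ ∈ S) :
    ∃ τ ∈ S, τ <:+ σ ∧ ∀ ρ ∈ S, ρ <:+ τ → ρ = τ := by
  induction hn : σ.length using Nat.strong_induction_on generalizing σ with
  | _ n ih =>
    by_cases h : ∀ ρ ∈ S, ρ <:+ σ → ρ = σ
    · exact ⟨σ, hσ, List.suffix_rfl, h⟩
    · push Not at h
      obtain ⟨ρ, hρ, hs, hne⟩ := h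
      have hlt : ρ.length < n :=
        hn ▸ lt_of_le_of_ne hs.length_le fun e => hne (hs.eq_of_length e)
      obtain ⟨τ, hτ, h1, h2⟩ := ih _ hlt hρ rfl
      exact ⟨τ, hτ, h1.trans hs, h2⟩

theorem biUnion_minimal_suffix {X : Type*} {A : List Bool → Set X}
    (hA : ∀ {σ τ}, τ <:+ σ → A σ ⊆ A τ) (S : Set (List Bool)) :
    ⋃ σ ∈ S, A σ = ⋃ σ ∈ {τ | τ ∈ S ∧ ∀ ρ ∈ S, ρ <:+ τ → ρ = τ}, A σ := by
  refine Set.Subset.antisymm (Set.iUnion₂_subset fun σ hσ => ?_)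
    (Set.biUnion_subset_biUnion_left fun τ hτ => hτ.1)
  obtain ⟨τ, hτ, hs, hmin⟩ := exists_minimal_suffix hσ
  exact (hA hs).trans (Set.subset_biUnion_of_mem (u := A)
    (show τ ∈ {τ | τ ∈ S ∧ ∀ ρ ∈ S, ρ <:+ τ → ρ = τ} from ⟨hτ, hmin⟩))

theorem atom_subset_of_suffix {σ τ : List Bool} (h : τ <:+ σ) : atom F σ ⊆ atom F τ := by
  induction σ with
  | nil => rw [List.suffix_nil.1 h]
  | cons b σ ih =>
    rcases List.suffix_cons_iff.1 h with rfl | h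
    · exact subset_rfl
    · exact Set.inter_subset_left.trans (ih h)

/-! ### The atoms containing a given point -/

/-- The literals whose conjunction is the atom denoted by a string. -/
def literals (σ : List Bool) : List (ℕ × Bool) :=
  List.rec [] (fun b σ IH => (σ.length, b) :: IH) σ

theorem primrec_literals : Primrec literals :=
  Primrec.list_rec Primrec.id (Primrec.const [])
    (Primrec.list_cons.comp
      (Primrec.pair (Primrec.list_length.comp
          (Primrec.fst.comp (Primrec.snd.comp Primrec.snd)))
        (Primrec.fst.comp Primrec.snd))
      (Primrec.snd.comp (Primrec.snd.comp Primrec.snd))).to₂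

theorem iInter_literals (σ : List Bool) :
    ⋂ l ∈ literals σ, signed F l.1 l.2 = atom F σ := by
  induction σ with
  | nil => simp [literals, atom]
  | cons b σ ih =>
    have : literals (b :: σ) = (σ.length, b) :: literals σ := rfl
    rw [this, atom, ← ih]
    ext ω
    simp [and_comm]

open Classical in
/-- The string of the atom of the algebra generated by the first `n` sets that contains `ω`. -/
noncomputable def address (F : ℕ → Set Ω) (ω : Ω) : ℕ → List Bool
  | 0 => []
  | n + 1 => decide (ω ∈ F n) :: address F ω n

theorem length_address (ω : Ω) (n : ℕ) : (address F ω n).length = n := by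
  induction n with
  | zero => rfl
  | succ n ih => simp [address, ih]

theorem address_suffix (ω : Ω) {m n : ℕ} (h : m ≤ n) : address F ω m <:+ address F ω n := by
  induction n, h using Nat.le_induction with
  | base => exact List.suffix_rfl
  | succ n _ ih => exact ih.trans (List.suffix_cons _ _)

theorem mem_signed_decide (ω : Ω) (n : ℕ) [Decidable (ω ∈ F n)] :
    ω ∈ signed F n (decide (ω ∈ F n)) := by
  by_cases h : ω ∈ F n <;> simp [signed, h]

open Classical in
theorem atom_address_eq (ω : Ω) (n : ℕ) : atom F (address F ω n) =
    ⋂ i < n, signed F i (decide (ω ∈ F i)) := by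
  induction n with
  | zero => simp [address, atom]
  | succ n ih => rw [address, atom, ih, length_address, Set.biInter_lt_succ]

theorem mem_atom_address (ω : Ω) (n : ℕ) : ω ∈ atom F (address F ω n) := by
  rw [atom_address_eq]
  exact Set.mem_iInter₂.2 fun i _ => by classical exact mem_signed_decide ω i

theorem mem_literals_address {ω : Ω} {i n : ℕ} {b : Bool} (hi : i < n) (h : ω ∈ signed F i b) :
    (i, b) ∈ literals (address F ω n) := by
  classical
  induction n, hi using Nat.le_induction with
  | base =>
    have : b = decide (ω ∈ F i) := by cases b <;> simp_all [signed]
    refine List.mem_cons.2 (Or.inl ?_)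
    rw [length_address, this]
  | succ n _ ih => exact List.mem_cons_of_mem _ ih

theorem mem_generatedAlgebra_iff {ω : Ω} {k : ℕ} : ω ∈ generatedAlgebra F k ↔
    ∃ d ∈ (Encodable.decode (α := List (List (ℕ × Bool))) k).getD default,
      ω ∈ ⋂ l ∈ d, signed F l.1 l.2 := by
  unfold generatedAlgebra
  cases Encodable.decode (α := List (List (ℕ × Bool))) k with
  | none =>
    simp only [Option.elim_none, Option.getD_none, Set.mem_empty_iff_false, false_iff]
    exact fun ⟨d, hd, _⟩ => List.not_mem_nil hd
  | some c => simp [evalDNF]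

theorem generatedAlgebra_literals (σ : List Bool) :
    generatedAlgebra F (Encodable.encode [literals σ]) = atom F σ := by
  simp only [generatedAlgebra, Encodable.encodek, Option.elim_some, evalDNF, List.mem_singleton,
    Set.iUnion_iUnion_eq_left]
  exact iInter_literals σ

theorem generatedAlgebra_nil :
    generatedAlgebra F (Encodable.encode ([] : List (List (ℕ × Bool)))) = ∅ := by
  simp [generatedAlgebra, evalDNF]

/-- The string `σ` settles the Boolean combination with code `k` positively: one of its
conjunctions has all its literals among those of `σ`. -/
def Forces (σ : List Bool) (k : ℕ) : Prop :=
  ∃ d ∈ (Encodable.decode (α := List (List (ℕ × Bool))) k).getD default,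
    ∀ l ∈ d, l ∈ literals σ

theorem primrecPred_forces {α : Type*} [Primcodable α] {s : α → List Bool} {k : α → ℕ}
    (hs : Primrec s) (hk : Primrec k) : PrimrecPred fun a => Forces (s a) (k a) := by
  have h1 : PrimrecRel fun (L : List (ℕ × Bool)) (l : ℕ × Bool) => ∃ a ∈ L, a = l :=
    PrimrecRel.exists_mem_list Primrec.eq
  have h1' : PrimrecRel fun (l : ℕ × Bool) (L : List (ℕ × Bool)) => ∃ a ∈ L, a = l :=
    PrimrecRel.comp₂ h1 Primrec₂.right Primrec₂.left
  have h2 : PrimrecRel fun (d L : List (ℕ × Bool)) => ∀ l ∈ d, ∃ a ∈ L, a = l :=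
    PrimrecRel.forall_mem_list h1'
  have h3 : PrimrecRel fun (c : List (List (ℕ × Bool))) (L : List (ℕ × Bool)) =>
      ∃ d ∈ c, ∀ l ∈ d, ∃ a ∈ L, a = l := PrimrecRel.exists_mem_list h2
  exact (h3.comp (Primrec.decode_getD.comp hk) (primrec_literals.comp hs)).of_eq
    fun a => by simp [Forces]

theorem atom_subset_of_forces {σ : List Bool} {k : ℕ} (h : Forces σ k) :
    atom F σ ⊆ generatedAlgebra F k := by
  intro ω hω
  obtain ⟨d, hd, hl⟩ := h
  rw [← iInter_literals] at hω
  exact mem_generatedAlgebra_iff.2 ⟨d, hd, Set.mem_iInter₂.2 fun l h =>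
    Set.mem_iInter₂.1 hω l (hl l h)⟩

theorem exists_forces_address {ω : Ω} {k : ℕ} (h : ω ∈ generatedAlgebra F k) :
    ∃ n, Forces (address F ω n) k := by
  obtain ⟨d, hd, hl⟩ := mem_generatedAlgebra_iff.1 h
  have hb : ∃ n, ∀ l ∈ d, l.1 < n := by
    refine ⟨(d.map Prod.fst).sum + 1, fun l h => Nat.lt_succ_of_le ?_⟩
    exact List.le_sum_of_mem (List.mem_map_of_mem h)
  obtain ⟨n, hn⟩ := hb
  exact ⟨n, d, hd, fun l h => mem_literals_address (hn l h) (Set.mem_iInter₂.1 hl l h)⟩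

end Strings

/-! ### The intervals of the atoms -/

section Intervals

variable {Ω : Type*} [MeasurableSpace Ω] {μ : Measure Ω} {F : ℕ → Set Ω}

/-- The right endpoint of the interval assigned to an atom. -/
noncomputable def rightEnd (μ : Measure Ω) (F : ℕ → Set Ω) (σ : List Bool) : ℝ :=
  leftEnd μ F σ + μ.real (atom F σ)

theorem measurableSet_atom (hF : ∀ i, MeasurableSet (F i)) :
    ∀ σ, MeasurableSet (atom F σ)
  | [] => MeasurableSet.univ
  | true :: σ => (measurableSet_atom hF σ).inter (hF _)
  | false :: σ => (measurableSet_atom hF σ).inter (hF _).compl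

theorem leftEnd_le_rightEnd (σ : List Bool) : leftEnd μ F σ ≤ rightEnd μ F σ :=
  le_add_of_nonneg_right measureReal_nonneg

theorem rightEnd_false [IsProbabilityMeasure μ] (hF : ∀ i, MeasurableSet (F i)) (σ : List Bool) :
    rightEnd μ F (false :: σ) = rightEnd μ F σ := by
  have h : μ.real (atom F (true :: σ)) + μ.real (atom F (false :: σ)) = μ.real (atom F σ) :=
    measureReal_inter_add_sdiff (hF σ.length)
  simp only [rightEnd, leftEnd]
  linarith

theorem leftEnd_le_of_suffix {σ τ : List Bool} (h : τ <:+ σ) :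
    leftEnd μ F τ ≤ leftEnd μ F σ := by
  induction σ with
  | nil => rw [List.suffix_nil.1 h]
  | cons b σ ih =>
    rcases List.suffix_cons_iff.1 h with rfl | h
    · exact le_rfl
    · refine (ih h).trans ?_
      cases b
      · exact le_add_of_nonneg_right measureReal_nonneg
      · exact le_rfl

theorem rightEnd_le_of_suffix [IsProbabilityMeasure μ] (hF : ∀ i, MeasurableSet (F i))
    {σ τ : List Bool} (h : τ <:+ σ) : rightEnd μ F σ ≤ rightEnd μ F τ := by
  induction σ with
  | nil => rw [List.suffix_nil.1 h]
  | cons b σ ih =>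
    rcases List.suffix_cons_iff.1 h with rfl | h
    · exact le_rfl
    · refine le_trans ?_ (ih h)
      cases b
      · exact (rightEnd_false hF σ).le
      · exact (leftEnd_le_rightEnd _).trans (rightEnd_false hF σ).le

theorem atomInterval_subset_of_suffix [IsProbabilityMeasure μ] (hF : ∀ i, MeasurableSet (F i))
    {σ τ : List Bool} (h : τ <:+ σ) : atomInterval μ F σ ⊆ atomInterval μ F τ :=
  Set.Ico_subset_Ico (leftEnd_le_of_suffix h) (rightEnd_le_of_suffix hF h)

theorem atomInterval_subset_Icc [IsProbabilityMeasure μ] (hF : ∀ i, MeasurableSet (F i))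
    (σ : List Bool) : atomInterval μ F σ ⊆ Set.Icc 0 1 := by
  refine (atomInterval_subset_of_suffix hF List.nil_suffix).trans ?_
  simpa [atomInterval, leftEnd, atom] using Set.Ico_subset_Icc_self

theorem disjoint_of_branch [IsProbabilityMeasure μ] (hF : ∀ i, MeasurableSet (F i))
    {σ τ ρ : List Bool} {b : Bool} (hσ : b :: ρ <:+ σ) (hτ : (!b) :: ρ <:+ τ) :
    Disjoint (atom F σ) (atom F τ) ∧ Disjoint (atomInterval μ F σ) (atomInterval μ F τ) := by
  have h1 : Disjoint (atom F (true :: ρ)) (atom F (false :: ρ)) :=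
    Set.disjoint_left.2 fun ω h h' => h'.2 h.2
  have h2 : Disjoint (atomInterval μ F (true :: ρ)) (atomInterval μ F (false :: ρ)) :=
    Set.Ico_disjoint_Ico_same
  suffices h : Disjoint (atom F (b :: ρ)) (atom F ((!b) :: ρ)) ∧
      Disjoint (atomInterval μ F (b :: ρ)) (atomInterval μ F ((!b) :: ρ)) from
    ⟨h.1.mono (atom_subset_of_suffix hσ) (atom_subset_of_suffix hτ),
      h.2.mono (atomInterval_subset_of_suffix hF hσ) (atomInterval_subset_of_suffix hF hτ)⟩
  cases b
  · exact ⟨h1.symm, h2.symm⟩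
  · exact ⟨h1, h2⟩

theorem volume_atomInterval [IsProbabilityMeasure μ] (σ : List Bool) :
    volume (atomInterval μ F σ) = μ (atom F σ) := by
  simp [atomInterval, Real.volume_Ico]

/-- The assignment of intervals to atoms preserves the measure of arbitrary unions: both unions
may be restricted to the minimal strings of `S`, for which they are disjoint. -/
theorem volume_iUnion_atomInterval [IsProbabilityMeasure μ] (hF : ∀ i, MeasurableSet (F i))
    (S : Set (List Bool)) :
    volume (⋃ σ ∈ S, atomInterval μ F σ) = μ (⋃ σ ∈ S, atom F σ) := by
  set M : Set (List Bool) := {τ | τ ∈ S ∧ ∀ ρ ∈ S, ρ <:+ τ → ρ = τ}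
  have hdisj : ∀ σ ∈ M, ∀ τ ∈ M, σ ≠ τ →
      Disjoint (atom F σ) (atom F τ) ∧ Disjoint (atomInterval μ F σ) (atomInterval μ F τ) := by
    intro σ hσ τ hτ hne
    rcases suffix_or_suffix_or_branch σ τ with h | h | ⟨ρ, b, h1, h2⟩
    · exact absurd (hτ.2 σ hσ.1 h) hne
    · exact absurd (hσ.2 τ hτ.1 h).symm hne
    · exact disjoint_of_branch hF h1 h2
  rw [biUnion_minimal_suffix (fun h => atomInterval_subset_of_suffix hF h) S,
    biUnion_minimal_suffix (fun h => atom_subset_of_suffix h) S,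
    measure_biUnion M.to_countable (fun σ hσ τ hτ hne => (hdisj σ hσ τ hτ hne).2)
      fun σ _ => measurableSet_Ico,
    measure_biUnion M.to_countable (fun σ hσ τ hτ hne => (hdisj σ hσ τ hτ hne).1)
      fun σ _ => measurableSet_atom hF σ]
  simp only [volume_atomInterval]

/-- Distinct strings may denote the same atom, but inclusion of atoms always implies inclusion of
their intervals. -/
theorem atomInterval_subset_of_atom_subset [IsProbabilityMeasure μ]
    (hF : ∀ i, MeasurableSet (F i)) {σ τ : List Bool} (h : atom F τ ⊆ atom F σ) :
    atomInterval μ F τ ⊆ atomInterval μ F σ := by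
  rcases suffix_or_suffix_or_branch σ τ with hs | hs | ⟨ρ, b, h1, h2⟩
  · exact atomInterval_subset_of_suffix hF hs
  · have e : atom F τ = atom F σ := h.antisymm (atom_subset_of_suffix hs)
    have hl := leftEnd_le_of_suffix (μ := μ) (F := F) hs
    have hr := rightEnd_le_of_suffix hF (μ := μ) hs
    simp only [rightEnd, e] at hr
    have : leftEnd μ F τ = leftEnd μ F σ := le_antisymm hl (by linarith)
    simp only [atomInterval, e, this, subset_rfl]
  · have hd := (disjoint_of_branch (μ := μ) hF h1 h2).1
    have he : atom F τ = ∅ := by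
      rw [← Set.subset_empty_iff]
      exact fun ω hω => (Set.disjoint_left.1 hd (h hω) hω).elim
    simp [atomInterval, he]

/-- Atoms are cofinal among the members of the algebra that contain `ω`. -/
theorem wcFiber_eq [IsProbabilityMeasure μ] (hF : ∀ i, MeasurableSet (F i)) (ω : Ω) :
    wcFiber μ F ω = ⋂ n, atomInterval μ F (address F ω n) := by
  refine Set.Subset.antisymm (fun x hx => Set.mem_iInter.2 fun n => ?_) fun x hx =>
    Set.mem_iInter₂.2 fun k hk => ?_
  · have h := Set.mem_iInter₂.1 hx (Encodable.encode [literals (address F ω n)])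
    rw [generatedAlgebra_literals] at h
    obtain ⟨τ, hτ, hxτ⟩ := Set.mem_iUnion₂.1 (h (mem_atom_address ω n))
    exact atomInterval_subset_of_atom_subset hF hτ hxτ
  · obtain ⟨n, hn⟩ := exists_forces_address hk
    exact Set.mem_iUnion₂.2 ⟨_, atom_subset_of_forces hn, Set.mem_iInter.1 hx n⟩

theorem tendsto_measureReal_atom_address [IsProbabilityMeasure μ]
    (hF : ∀ i, MeasurableSet (F i)) (hna : IsNonAtomic μ F) (ω : Ω) :
    Filter.Tendsto (fun n => μ.real (atom F (address F ω n))) Filter.atTop (nhds 0) := by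
  classical
  have h := tendsto_measure_iInter_atTop (μ := μ) (s := fun n => atom F (address F ω n))
    (fun n => (measurableSet_atom hF _).nullMeasurableSet)
    (fun m n h => atom_subset_of_suffix (address_suffix ω h)) ⟨0, measure_ne_top _ _⟩
  have h0 : μ (⋂ n, atom F (address F ω n)) = 0 := by
    refine measure_mono_null (fun x hx => Set.mem_iInter.2 fun k => ?_)
      (hna fun k => decide (ω ∈ F k))
    have := Set.mem_iInter.1 hx (k + 1)
    rw [atom_address_eq] at this
    convert Set.mem_iInter₂.1 this k k.lt_succ_self
  rw [h0] at h
  exact (ENNReal.tendsto_toReal ENNReal.zero_ne_top).comp h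

/-- The left and right endpoints of the intervals around `ω` converge to a common limit, which
lies between all of them. -/
theorem exists_tendsto_endpoints [IsProbabilityMeasure μ] (hF : ∀ i, MeasurableSet (F i))
    (hna : IsNonAtomic μ F) (ω : Ω) :
    ∃ x, Filter.Tendsto (fun n => leftEnd μ F (address F ω n)) Filter.atTop (nhds x) ∧
      Filter.Tendsto (fun n => rightEnd μ F (address F ω n)) Filter.atTop (nhds x) ∧
      ∀ n, leftEnd μ F (address F ω n) ≤ x ∧ x ≤ rightEnd μ F (address F ω n) := by
  have hmono : Monotone fun n => leftEnd μ F (address F ω n) := fun m n h =>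
    leftEnd_le_of_suffix (address_suffix ω h)
  have hanti : Antitone fun n => rightEnd μ F (address F ω n) := fun m n h =>
    rightEnd_le_of_suffix hF (address_suffix ω h)
  have hbdd : BddAbove (Set.range fun n => leftEnd μ F (address F ω n)) := by
    refine ⟨rightEnd μ F (address F ω 0), ?_⟩
    rintro _ ⟨n, rfl⟩
    exact (leftEnd_le_rightEnd _).trans (hanti n.zero_le)
  have hl := tendsto_atTop_ciSup hmono hbdd
  have hr := hl.add (tendsto_measureReal_atom_address hF hna ω)
  rw [add_zero] at hr
  exact ⟨_, hl, hr, fun n => ⟨hmono.ge_of_tendsto hl n, hanti.le_of_tendsto hr n⟩⟩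

/-! ### Endpoints as signed sums -/

/-- Inclusion–exclusion for the measure of an atom. -/
def atomTerms (σ : List Bool) : List (Bool × List ℕ) :=
  List.rec [(true, [])] (fun b σ IH =>
    bif b then IH.map fun x => (x.1, x.2 ++ [σ.length])
    else IH ++ IH.map fun x => (!x.1, x.2 ++ [σ.length])) σ

/-- The signed intersections that add up to the left endpoint of an atom. -/
def leftTerms (σ : List Bool) : List (Bool × List ℕ) :=
  List.rec [] (fun b σ IH => bif b then IH else IH ++ atomTerms (true :: σ)) σ

/-- The signed intersections that add up to the right endpoint of an atom. -/
def rightTerms (σ : List Bool) : List (Bool × List ℕ) :=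
  leftTerms σ ++ atomTerms σ

theorem primrec_atomTerms : Primrec atomTerms := by
  let Q := List Bool × Bool × List Bool × List (Bool × List ℕ)
  have hIH : Primrec fun p : Q => p.2.2.2 := Primrec.snd.comp (Primrec.snd.comp Primrec.snd)
  have hn : Primrec fun p : Q => p.2.2.1.length :=
    Primrec.list_length.comp (Primrec.fst.comp (Primrec.snd.comp Primrec.snd))
  have happ : Primrec₂ fun (p : Q) (x : Bool × List ℕ) => x.2 ++ [p.2.2.1.length] :=
    (Primrec.list_concat.comp (Primrec.snd.comp Primrec.snd) (hn.comp Primrec.fst)).to₂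
  exact Primrec.list_rec Primrec.id (Primrec.const [(true, [])])
    (Primrec.cond (Primrec.fst.comp Primrec.snd)
      (Primrec.list_map hIH ((Primrec.fst.comp Primrec.snd).pair happ).to₂)
      (Primrec.list_append.comp hIH (Primrec.list_map hIH
        ((Primrec.not.comp (Primrec.fst.comp Primrec.snd)).pair happ).to₂))).to₂

theorem primrec_leftTerms : Primrec leftTerms := by
  let Q := List Bool × Bool × List Bool × List (Bool × List ℕ)
  have hIH : Primrec fun p : Q => p.2.2.2 := Primrec.snd.comp (Primrec.snd.comp Primrec.snd)
  exact Primrec.list_rec Primrec.id (Primrec.const [])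
    (Primrec.cond (Primrec.fst.comp Primrec.snd) hIH
      (Primrec.list_append.comp hIH (primrec_atomTerms.comp
        (Primrec.list_cons.comp (Primrec.const true)
          (Primrec.fst.comp (Primrec.snd.comp Primrec.snd)))))).to₂

theorem primrec_rightTerms : Primrec rightTerms :=
  Primrec.list_append.comp primrec_leftTerms primrec_atomTerms

theorem atomTerms_true (σ : List Bool) :
    atomTerms (true :: σ) = (atomTerms σ).map fun x => (x.1, x.2 ++ [σ.length]) := rfl

theorem atomTerms_false (σ : List Bool) : atomTerms (false :: σ) =
    atomTerms σ ++ (atomTerms σ).map fun x => (!x.1, x.2 ++ [σ.length]) := rfl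

theorem sorted_atomTerms (σ : List Bool) :
    ∀ x ∈ atomTerms σ, x.2.Pairwise (· < ·) ∧ ∀ i ∈ x.2, i < σ.length := by
  induction σ with
  | nil => simp [atomTerms]
  | cons b σ ih =>
    have key : ∀ y ∈ atomTerms σ, (y.2 ++ [σ.length]).Pairwise (· < ·) ∧
        ∀ i ∈ y.2 ++ [σ.length], i < (b :: σ).length := by
      intro y hy
      refine ⟨List.pairwise_append.2 ⟨(ih y hy).1, List.pairwise_singleton _ _, ?_⟩, ?_⟩
      · simpa using (ih y hy).2
      · intro i hi
        rcases List.mem_append.1 hi with hi | hi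
        · exact ((ih y hy).2 i hi).trans (by simp)
        · simp_all
    intro x hx
    cases b
    · rw [atomTerms_false, List.mem_append, List.mem_map] at hx
      rcases hx with hx | ⟨y, hy, rfl⟩
      · exact ⟨(ih x hx).1, fun i hi => ((ih x hx).2 i hi).trans (by simp)⟩
      · exact key y hy
    · rw [atomTerms_true, List.mem_map] at hx
      obtain ⟨y, hy, rfl⟩ := hx
      exact key y hy

theorem sorted_leftTerms (σ : List Bool) : ∀ x ∈ leftTerms σ, x.2.Pairwise (· < ·) := by
  induction σ with
  | nil => simp [leftTerms]
  | cons b σ ih =>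
    intro x hx
    cases b
    · rcases List.mem_append.1 (show x ∈ leftTerms σ ++ atomTerms (true :: σ) from hx) with hx | hx
      · exact ih x hx
      · exact (sorted_atomTerms _ x hx).1
    · exact ih x hx

theorem sorted_rightTerms (σ : List Bool) : ∀ x ∈ rightTerms σ, x.2.Pairwise (· < ·) := by
  intro x hx
  rcases List.mem_append.1 hx with hx | hx
  · exact sorted_leftTerms σ x hx
  · exact (sorted_atomTerms σ x hx).1

theorem termsVal_append (L M : List (Bool × List ℕ)) :
    termsVal μ F (L ++ M) = termsVal μ F L + termsVal μ F M := by
  simp [termsVal]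

/-- Inclusion–exclusion inside an arbitrary measurable set `B`; the freedom in `B` carries the
induction, which replaces `B` by its intersection with the last set split. -/
theorem sum_atomTerms_inter [IsProbabilityMeasure μ] (hF : ∀ i, MeasurableSet (F i))
    (σ : List Bool) {B : Set Ω} (hB : MeasurableSet B) :
    ((atomTerms σ).map fun x =>
      (if x.1 then 1 else -1) * μ.real ((⋂ i ∈ x.2, F i) ∩ B)).sum = μ.real (atom F σ ∩ B) := by
  induction σ generalizing B with
  | nil => simp [atomTerms, atom]
  | cons b σ ih =>
    have hi : ∀ l : List ℕ, (⋂ i ∈ l ++ [σ.length], F i) ∩ B =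
        (⋂ i ∈ l, F i) ∩ (F σ.length ∩ B) := by
      intro l
      ext ω
      simp only [List.mem_append, List.mem_singleton, Set.mem_inter_iff, Set.mem_iInter, or_imp,
        forall_and, forall_eq, and_assoc]
    have h1 := ih ((hF σ.length).inter hB)
    have ht : atom F (true :: σ) ∩ B = atom F σ ∩ (F σ.length ∩ B) := by
      simp [atom, signed, Set.inter_assoc]
    cases b
    · have hneg : ∀ x : Bool × List ℕ, (if (!x.1) = true then (1 : ℝ) else -1) *
          μ.real ((⋂ i ∈ x.2, F i) ∩ (F σ.length ∩ B)) =
          -((if x.1 then 1 else -1) * μ.real ((⋂ i ∈ x.2, F i) ∩ (F σ.length ∩ B))) := by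
        rintro ⟨s, l⟩
        cases s <;> simp
      rw [atomTerms_false, List.map_append, List.sum_append, ih hB, List.map_map]
      simp only [Function.comp_def, hi, hneg]
      have hsum : ∀ (L : List (Bool × List ℕ)) (f : Bool × List ℕ → ℝ),
          (L.map fun x => -f x).sum = -(L.map f).sum := fun L f => by
        induction L <;> simp_all [add_comm]
      rw [hsum, h1]
      have h2 := measureReal_inter_add_sdiff (μ := μ) (s := atom F σ ∩ B) (hF σ.length)
      have e1 : atom F σ ∩ B ∩ F σ.length = atom F σ ∩ (F σ.length ∩ B) := by
        rw [Set.inter_assoc, Set.inter_comm B]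
      have e2 : (atom F σ ∩ B) \ F σ.length = atom F (false :: σ) ∩ B := by
        ext ω
        simp only [atom, signed, Set.mem_sdiff, Set.mem_inter_iff, Bool.false_eq_true, if_false,
          Set.mem_compl_iff]
        tauto
      rw [e1, e2] at h2
      linarith
    · rw [atomTerms_true, List.map_map, ht, ← h1]
      simp only [Function.comp_def, hi]

theorem termsVal_atomTerms [IsProbabilityMeasure μ] (hF : ∀ i, MeasurableSet (F i))
    (σ : List Bool) : termsVal μ F (atomTerms σ) = μ.real (atom F σ) := by
  simpa [termsVal] using sum_atomTerms_inter (μ := μ) hF σ MeasurableSet.univ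

theorem termsVal_leftTerms [IsProbabilityMeasure μ] (hF : ∀ i, MeasurableSet (F i))
    (σ : List Bool) : termsVal μ F (leftTerms σ) = leftEnd μ F σ := by
  induction σ with
  | nil => simp [leftTerms, termsVal, leftEnd]
  | cons b σ ih =>
    cases b
    · have : leftTerms (false :: σ) = leftTerms σ ++ atomTerms (true :: σ) := rfl
      rw [this, termsVal_append, ih, termsVal_atomTerms hF, leftEnd]
    · exact ih

theorem termsVal_rightTerms [IsProbabilityMeasure μ] (hF : ∀ i, MeasurableSet (F i))
    (σ : List Bool) : termsVal μ F (rightTerms σ) = rightEnd μ F σ := by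
  rw [rightTerms, termsVal_append, termsVal_leftTerms hF, termsVal_atomTerms hF, rightEnd]

end Intervals

section Tests

variable {Ω : Type*} [MeasurableSpace Ω] {μ : Measure Ω} {F : ℕ → Set Ω} {t : unitInterval}
  {b : List ℕ × ℕ → ℕ}

/-! ### Computable numbers are not random -/

theorem codedRat_dyadic (p q k : ℕ) :
    ((codedRat (p, q, 2 ^ k - 1) : ℚ) : ℝ) = ((p : ℝ) - q) / 2 ^ k := by
  have h : ((2 ^ k - 1 : ℕ) : ℝ) + 1 = 2 ^ k := by
    exact_mod_cast Nat.sub_add_cancel (Nat.one_le_two_pow (n := k))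
  simp only [codedRat]
  push_cast [h]
  rfl

/-- The code of the interval of length `2 * n / 2 ^ k` around `(s.1 - s.2) / 2 ^ k`. -/
def dyadicInterval (n : ℕ) (s : ℕ × ℕ) (k : ℕ) : (ℕ × ℕ × ℕ) × (ℕ × ℕ × ℕ) :=
  ((s.1, s.2 + n, 2 ^ k - 1), (s.1 + n, s.2, 2 ^ k - 1))

theorem primrec_dyadicInterval (n : ℕ) :
    Primrec fun p : (ℕ × ℕ) × ℕ => dyadicInterval n p.1 p.2 := by
  have h1 : Primrec fun q : (ℕ × ℕ) × ℕ => q.1.1 := Primrec.fst.comp Primrec.fst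
  have h2 : Primrec fun q : (ℕ × ℕ) × ℕ => q.1.2 := Primrec.snd.comp Primrec.fst
  have hd : Primrec fun q : (ℕ × ℕ) × ℕ => 2 ^ q.2 - 1 :=
    Primrec.nat_sub.comp (Primrec.nat_pow.comp (Primrec.const 2) Primrec.snd) (Primrec.const 1)
  exact (h1.pair ((Primrec.nat_add.comp h2 (Primrec.const n)).pair hd)).pair
    ((Primrec.nat_add.comp h1 (Primrec.const n)).pair (h2.pair hd))

/-- A signed sum of measures of intersections is computable relative to `t`, so it is not random:
its approximations provide a test consisting of single intervals. -/
theorem termsVal_notMem_RAND (hb : ComputableIn (oracle t) b) (hμ : IsApprox μ F b)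
    {L : List (Bool × List ℕ)} (hL : ∀ x ∈ L, x.2.Pairwise (· < ·)) :
    termsVal μ F L ∉ RAND t := by
  rintro ⟨-, hx⟩
  set C := 2 * L.length with hC
  -- At precision `n + (2 * C + 2)` the enclosing interval has length at most `2 ^ (-n)`, because
  -- `2 * C + 2 ≤ 2 ^ (2 * C + 2)`.
  let k : ℕ → ℕ := fun n => n + (2 * C + 2)
  let s : ℕ → ℕ × ℕ := fun n => approxTerms b L (k n)
  let e : ℕ → ℕ → (ℕ × ℕ × ℕ) × (ℕ × ℕ × ℕ) := fun n _ => dyadicInterval (C + 1) (s n) (k n)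
  have hU : ∀ n, codedOpen (e n) =
      Set.Ioo ((((s n).1 : ℝ) - (s n).2 - (C + 1)) / 2 ^ k n)
        ((((s n).1 : ℝ) - (s n).2 + (C + 1)) / 2 ^ k n) := by
    intro n
    simp only [codedOpen, e, dyadicInterval, codedRat_dyadic, Set.iUnion_const]
    push_cast
    congr 2 <;> ring
  refine hx (fun n => codedOpen (e n)) ⟨e, ?_, fun n => rfl, fun n => ?_⟩
    (Set.mem_iInter.2 fun n => ?_)
  · have hk : Primrec fun p : ℕ × ℕ => k p.1 :=
      Primrec.nat_add.comp Primrec.fst (Primrec.const _)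
    have hs : ComputableIn (oracle t) fun p : ℕ × ℕ => s p.1 :=
      (computableIn_approxTerms hb).comp (ComputableIn.const L) hk.computableIn
    have h := (primrec_dyadicInterval (C + 1)).computableIn.comp (hs.pair hk.computableIn)
    exact h
  · refine (measure_mono Set.inter_subset_left).trans ?_
    beta_reduce
    rw [hU, Real.volume_Ioo]
    have h2C : (2 * (C : ℝ) + 2) ≤ 2 ^ (2 * C + 2) := by
      exact_mod_cast (Nat.lt_two_pow_self (n := 2 * C + 2)).le
    have hle : ((((s n).1 : ℝ) - (s n).2 + (C + 1)) / 2 ^ k n) -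
        ((((s n).1 : ℝ) - (s n).2 - (C + 1)) / 2 ^ k n) ≤ (2⁻¹ : ℝ) ^ n := by
      rw [← sub_div, div_le_iff₀ (by positivity)]
      simp only [k, pow_add (2 : ℝ) n]
      rw [← mul_assoc, ← mul_pow, inv_mul_cancel₀ two_ne_zero, one_pow, one_mul]
      linarith
    refine (ENNReal.ofReal_le_ofReal hle).trans (le_of_eq ?_)
    rw [ENNReal.ofReal_pow (by norm_num), ENNReal.ofReal_inv_of_pos two_pos, ENNReal.ofReal_ofNat]
  · rw [hU]
    have h := abs_le.1 (abs_sub_approxTerms_le hμ hL (k n))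
    have hpos : (0 : ℝ) < 2 ^ k n := by positivity
    have hC' : (C : ℝ) = 2 * L.length := by rw [hC]; push_cast; rfl
    simp only [← hC'] at h
    constructor
    · rw [div_lt_iff₀ hpos]
      simp only [s]
      linarith
    · rw [lt_div_iff₀ hpos]
      simp only [s]
      linarith

/-! ### Transfer of tests -/

/-- By the approximations `l` and `r` of precision `k`, the closed interval of the atom `σ` lies
in the rational interval with code `c`. -/
def LiesIn (c : (ℕ × ℕ × ℕ) × (ℕ × ℕ × ℕ)) (σ : List Bool) (k : ℕ) (l r : ℕ × ℕ) : Prop :=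
  Below c.1 l (leftTerms σ).length k ∧ Below (negCode c.2) r.swap (rightTerms σ).length k

instance (c : (ℕ × ℕ × ℕ) × (ℕ × ℕ × ℕ)) (σ : List Bool) (k : ℕ) (l r : ℕ × ℕ) :
    Decidable (LiesIn c σ k l r) := inferInstanceAs (Decidable (_ ∧ _))

/-- The code of the atom `σ` if it is found to lie in the interval coded by `c`, and of the empty
set otherwise. -/
def pullbackCode (c : (ℕ × ℕ × ℕ) × (ℕ × ℕ × ℕ)) (p : List Bool × ℕ) (s : (ℕ × ℕ) × (ℕ × ℕ)) : ℕ :=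
  Encodable.encode (if LiesIn c p.1 p.2 s.1 s.2 then [literals p.1] else [])

theorem primrec_pullbackCode :
    Primrec fun q : ((ℕ × ℕ × ℕ) × (ℕ × ℕ × ℕ)) × (List Bool × ℕ) × (ℕ × ℕ) × (ℕ × ℕ) =>
      pullbackCode q.1 q.2.1 q.2.2 := by
  let R := ((ℕ × ℕ × ℕ) × (ℕ × ℕ × ℕ)) × (List Bool × ℕ) × (ℕ × ℕ) × (ℕ × ℕ)
  have hσ : Primrec fun q : R => q.2.1.1 := Primrec.fst.comp (Primrec.fst.comp Primrec.snd)
  have hk : Primrec fun q : R => q.2.1.2 := Primrec.snd.comp (Primrec.fst.comp Primrec.snd)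
  have hl : Primrec fun q : R => q.2.2.1 := Primrec.fst.comp (Primrec.snd.comp Primrec.snd)
  have hr : Primrec fun q : R => q.2.2.2 := Primrec.snd.comp (Primrec.snd.comp Primrec.snd)
  have hc1 : Primrec fun q : R => q.1.1 := Primrec.fst.comp Primrec.fst
  have hc2 : Primrec fun q : R => q.1.2 := Primrec.snd.comp Primrec.fst
  have hgood : PrimrecPred fun q : R => LiesIn q.1 q.2.1.1 q.2.1.2 q.2.2.1 q.2.2.2 :=
    (primrecPred_below hc1 hl (Primrec.list_length.comp (primrec_leftTerms.comp hσ)) hk).and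
      (primrecPred_below (primrec_negCode.comp hc2) (primrec_swap.comp hr)
        (Primrec.list_length.comp (primrec_rightTerms.comp hσ)) hk)
  exact Primrec.encode.comp (Primrec.ite hgood
    (Primrec.list_cons.comp (primrec_literals.comp hσ) (Primrec.const [])) (Primrec.const []))

/-- The string `σ` settles the Boolean combination with code `i` positively and, by the
approximations `l` and `r` of precision `k`, the endpoints coded by `c` are inside the interval of
the atom `σ`. -/
def CoveredBy (i : ℕ) (c : (ℕ × ℕ × ℕ) × (ℕ × ℕ × ℕ)) (σ : List Bool) (k : ℕ) (l r : ℕ × ℕ) :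
    Prop :=
  Forces σ i ∧ Below (negCode c.1) l.swap (leftTerms σ).length k ∧
    Below c.2 r (rightTerms σ).length k

open Classical in
/-- The interval with code `c` if it is found to be covered by a set of the algebra, and the empty
interval otherwise. -/
noncomputable def pushforwardCode (i : ℕ) (c : (ℕ × ℕ × ℕ) × (ℕ × ℕ × ℕ)) (p : List Bool × ℕ)
    (s : (ℕ × ℕ) × (ℕ × ℕ)) : (ℕ × ℕ × ℕ) × (ℕ × ℕ × ℕ) :=
  if CoveredBy i c p.1 p.2 s.1 s.2 then c else ((0, 0, 0), (0, 0, 0))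

theorem primrec_pushforwardCode :
    Primrec fun q : ℕ × ((ℕ × ℕ × ℕ) × (ℕ × ℕ × ℕ)) × (List Bool × ℕ) × (ℕ × ℕ) × (ℕ × ℕ) =>
      pushforwardCode q.1 q.2.1 q.2.2.1 q.2.2.2 := by
  classical
  let R := ℕ × ((ℕ × ℕ × ℕ) × (ℕ × ℕ × ℕ)) × (List Bool × ℕ) × (ℕ × ℕ) × (ℕ × ℕ)
  have hc : Primrec fun q : R => q.2.1 := Primrec.fst.comp Primrec.snd
  have hp : Primrec fun q : R => q.2.2.1 := Primrec.fst.comp (Primrec.snd.comp Primrec.snd)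
  have hs : Primrec fun q : R => q.2.2.2 := Primrec.snd.comp (Primrec.snd.comp Primrec.snd)
  have hσ : Primrec fun q : R => q.2.2.1.1 := Primrec.fst.comp hp
  have hk : Primrec fun q : R => q.2.2.1.2 := Primrec.snd.comp hp
  have hl : Primrec fun q : R => q.2.2.2.1 := Primrec.fst.comp hs
  have hr : Primrec fun q : R => q.2.2.2.2 := Primrec.snd.comp hs
  have hgood : PrimrecPred fun q : R =>
      CoveredBy q.1 q.2.1 q.2.2.1.1 q.2.2.1.2 q.2.2.2.1 q.2.2.2.2 :=
    (primrecPred_forces hσ Primrec.fst).and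
      ((primrecPred_below (primrec_negCode.comp (Primrec.fst.comp hc)) (primrec_swap.comp hl)
        (Primrec.list_length.comp (primrec_leftTerms.comp hσ)) hk).and
      (primrecPred_below (Primrec.snd.comp hc) hr
        (Primrec.list_length.comp (primrec_rightTerms.comp hσ)) hk))
  exact Primrec.ite hgood hc (Primrec.const ((0, 0, 0), (0, 0, 0)))

/-- The approximations of precision `k` of the endpoints of the interval of `σ`. -/
def approxEnds (b : List ℕ × ℕ → ℕ) (p : List Bool × ℕ) : (ℕ × ℕ) × (ℕ × ℕ) :=
  (approxTerms b (leftTerms p.1) p.2, approxTerms b (rightTerms p.1) p.2)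

theorem computableIn_approxEnds (hb : ComputableIn (oracle t) b) :
    ComputableIn (oracle t) (approxEnds b) := by
  have h {T : List Bool → List (Bool × List ℕ)} (hT : Primrec T) :
      ComputableIn (oracle t) fun p : List Bool × ℕ => approxTerms b (T p.1) p.2 :=
    (computableIn_approxTerms hb).comp (hT.comp Primrec.fst).computableIn ComputableIn.snd
  exact (h primrec_leftTerms).pair (h primrec_rightTerms)

/-- The codes of the atoms that lie in an interval of the `n`-th set of a test, enumerated by the
candidates `(m, σ, k)`: interval number, string and precision. -/
theorem computableIn_pullback (hb : ComputableIn (oracle t) b)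
    {e : ℕ → ℕ → (ℕ × ℕ × ℕ) × (ℕ × ℕ × ℕ)} (he : ComputableIn₂ (oracle t) e) :
    ComputableIn₂ (oracle t) fun (n : ℕ) (q : ℕ × List Bool × ℕ) =>
      pullbackCode (e n q.1) q.2 (approxEnds b q.2) := by
  have hq : Primrec fun p : ℕ × ℕ × List Bool × ℕ => p.2.2 := Primrec.snd.comp Primrec.snd
  have he' : ComputableIn (oracle t) fun p : ℕ × ℕ × List Bool × ℕ => e p.1 p.2.1 :=
    he.comp ComputableIn.fst (Primrec.fst.comp Primrec.snd).computableIn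
  have h := primrec_pullbackCode.computableIn.comp (he'.pair (hq.computableIn.pair
    ((computableIn_approxEnds hb).comp hq.computableIn)))
  exact h

/-- The codes of the rational intervals covered by one of the sets with codes `f (ψ n) m`,
enumerated by the candidates `(m, c, σ, k)`: number of the set, endpoints, string and precision. -/
theorem computableIn_pushforward (hb : ComputableIn (oracle t) b)
    {f : ℕ → ℕ → ℕ} (hf : ComputableIn₂ (oracle t) f) {ψ : ℕ → ℕ} (hψ : Computable ψ) :
    ComputableIn₂ (oracle t)
      fun (n : ℕ) (q : ℕ × ((ℕ × ℕ × ℕ) × (ℕ × ℕ × ℕ)) × List Bool × ℕ) =>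
        pushforwardCode (f (ψ n) q.1) q.2.1 q.2.2 (approxEnds b q.2.2) := by
  let R := ℕ × ℕ × ((ℕ × ℕ × ℕ) × (ℕ × ℕ × ℕ)) × List Bool × ℕ
  have hc : Primrec fun p : R => p.2.2.1 := Primrec.fst.comp (Primrec.snd.comp Primrec.snd)
  have hq : Primrec fun p : R => p.2.2.2 := Primrec.snd.comp (Primrec.snd.comp Primrec.snd)
  have hf' : ComputableIn (oracle t) fun p : R => f (ψ p.1) p.2.1 :=
    hf.comp (hψ.computableIn.comp ComputableIn.fst) (Primrec.fst.comp Primrec.snd).computableIn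
  have h := primrec_pushforwardCode.computableIn.comp (hf'.pair (hc.computableIn.pair
    (hq.computableIn.pair ((computableIn_approxEnds hb).comp hq.computableIn))))
  exact h

theorem exists_computableIn_reindex {α σ : Type*} [Primcodable α] [Inhabited α] [Primcodable σ]
    {O : Set (ℕ →. ℕ)} {g : ℕ → α → σ} (hg : ComputableIn₂ O g) :
    ∃ f : ℕ → ℕ → σ, ComputableIn₂ O f ∧ ∀ n, Set.range (f n) = Set.range (g n) := by
  refine ⟨fun n j => g n ((Encodable.decode (α := α) j).getD default), ?_, fun n => ?_⟩
  · exact hg.comp ComputableIn.fst (Primrec.decode_getD.comp Primrec.snd).computableIn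
  · refine Set.Subset.antisymm (Set.range_comp_subset_range _ (g n)) ?_
    rintro _ ⟨a, rfl⟩
    exact ⟨Encodable.encode a, by simp [Encodable.encodek]⟩

variable [IsProbabilityMeasure μ]

theorem abs_sub_approx_leftEnd_le (hF : ∀ i, MeasurableSet (F i)) (hμ : IsApprox μ F b)
    (σ : List Bool) (k : ℕ) :
    |2 ^ k * leftEnd μ F σ - (((approxTerms b (leftTerms σ) k).1 : ℝ) -
      (approxTerms b (leftTerms σ) k).2)| ≤ 2 * (leftTerms σ).length := by
  rw [← termsVal_leftTerms hF]
  exact abs_sub_approxTerms_le hμ (sorted_leftTerms σ) k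

theorem abs_sub_approx_rightEnd_le (hF : ∀ i, MeasurableSet (F i)) (hμ : IsApprox μ F b)
    (σ : List Bool) (k : ℕ) :
    |2 ^ k * rightEnd μ F σ - (((approxTerms b (rightTerms σ) k).1 : ℝ) -
      (approxTerms b (rightTerms σ) k).2)| ≤ 2 * (rightTerms σ).length := by
  rw [← termsVal_rightTerms hF]
  exact abs_sub_approxTerms_le hμ (sorted_rightTerms σ) k

/-- A Martin-Löf test `V` is pulled back to the unions of the atoms whose closed intervals lie
inside one of the rational intervals that make up `V n`. -/
theorem exists_isEffectiveNull_of_isMLTest (hF : ∀ i, MeasurableSet (F i))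
    (hb : ComputableIn (oracle t) b) (hμ : IsApprox μ F b) {V : ℕ → Set ℝ} (hV : IsMLTest t V) :
    ∃ A, IsEffectiveNull μ t (generatedAlgebra F) A ∧
      ∀ ω x, Filter.Tendsto (fun n => leftEnd μ F (address F ω n)) Filter.atTop (nhds x) →
        Filter.Tendsto (fun n => rightEnd μ F (address F ω n)) Filter.atTop (nhds x) →
        x ∈ ⋂ n, V n → ω ∈ A := by
  obtain ⟨e, he, hVe, hvol⟩ := hV
  obtain ⟨f, hf, hrange⟩ := exists_computableIn_reindex (computableIn_pullback hb he)
  refine ⟨⋂ n, ⋃ j, generatedAlgebra F (f n j), ⟨f, hf, subset_rfl, id, Computable.id, ?_⟩, ?_⟩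
  · intro k n hkn
    let S : Set (List Bool) := {σ | atomInterval μ F σ ⊆ V n}
    have hsub : ⋃ j, generatedAlgebra F (f n j) ⊆ ⋃ σ ∈ S, atom F σ := by
      refine Set.iUnion_subset fun j => ?_
      obtain ⟨⟨m, σ, k⟩, hj⟩ := (hrange n).subset (Set.mem_range_self j)
      simp only [← hj, pullbackCode]
      split_ifs with hg
      · rw [generatedAlgebra_literals]
        refine Set.subset_biUnion_of_mem (u := fun σ => atom F σ) ?_
        show atomInterval μ F σ ⊆ V n
        rw [hVe]
        have h1 := codedRat_lt_of_below (abs_sub_approx_leftEnd_le hF hμ _ _) hg.1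
        have h2 := lt_codedRat_of_below (abs_sub_approx_rightEnd_le hF hμ _ _) hg.2
        exact fun x hx => Set.mem_iUnion.2 ⟨m, h1.trans_le hx.1, hx.2.trans h2⟩
      · rw [generatedAlgebra_nil]
        exact Set.empty_subset _
    calc μ (⋃ j, generatedAlgebra F (f n j)) ≤ μ (⋃ σ ∈ S, atom F σ) := measure_mono hsub
      _ = volume (⋃ σ ∈ S, atomInterval μ F σ) := (volume_iUnion_atomInterval hF S).symm
      _ ≤ volume (V n ∩ Set.Icc 0 1) := measure_mono
          (Set.iUnion₂_subset fun σ hσ => Set.subset_inter hσ (atomInterval_subset_Icc hF σ))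
      _ ≤ 2⁻¹ ^ n := hvol n
      _ ≤ 2⁻¹ ^ k := pow_le_pow_right_of_le_one' (by simp) hkn
  · intro ω x hl hr hx
    refine Set.mem_iInter.2 fun n => ?_
    have hxn := Set.mem_iInter.1 hx n
    rw [hVe] at hxn
    obtain ⟨m, hm1, hm2⟩ := Set.mem_iUnion.1 hxn
    obtain ⟨N, h1, h2⟩ := ((hl.eventually (lt_mem_nhds hm1)).and
      (hr.eventually (gt_mem_nhds hm2))).exists
    obtain ⟨k, hk1, hk2⟩ := ((eventually_below (abs_sub_approx_leftEnd_le hF hμ _) h1).and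
      (eventually_below_swap (abs_sub_approx_rightEnd_le hF hμ _) h2)).exists
    obtain ⟨j, hj⟩ := (hrange n).superset (Set.mem_range_self (m, address F ω N, k))
    refine Set.mem_iUnion.2 ⟨j, ?_⟩
    rw [hj, pullbackCode, if_pos ⟨hk1, hk2⟩, generatedAlgebra_literals]
    exact mem_atom_address ω N

/-- An effectively null set is pushed forward to the unions of the rational intervals strictly
inside the intervals of those atoms that settle one of the covering sets positively. -/
theorem exists_isMLTest_of_isEffectiveNull (hF : ∀ i, MeasurableSet (F i))
    (hb : ComputableIn (oracle t) b) (hμ : IsApprox μ F b) {A : Set Ω}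
    (hA : IsEffectiveNull μ t (generatedAlgebra F) A) :
    ∃ V, IsMLTest t V ∧ ∀ ω ∈ A, ∀ x,
      (∀ n, x ∈ Set.Ioo (leftEnd μ F (address F ω n)) (rightEnd μ F (address F ω n))) →
        x ∈ ⋂ n, V n := by
  obtain ⟨f, hf, hAf, ψ, hψ, hmeas⟩ := hA
  obtain ⟨e, he, hrange⟩ := exists_computableIn_reindex (computableIn_pushforward hb hf hψ)
  refine ⟨fun n => codedOpen (e n), ⟨e, he, fun n => rfl, fun n => ?_⟩, ?_⟩
  · let S : Set (List Bool) := {σ | ∃ m, atom F σ ⊆ generatedAlgebra F (f (ψ n) m)}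
    have hsub : codedOpen (e n) ⊆ ⋃ σ ∈ S, atomInterval μ F σ := by
      refine Set.iUnion_subset fun j => ?_
      obtain ⟨⟨m, c, σ, k⟩, hj⟩ := (hrange n).subset (Set.mem_range_self j)
      simp only [← hj, pushforwardCode]
      split_ifs with hg
      · have h1 := lt_codedRat_of_below (abs_sub_approx_leftEnd_le hF hμ _ _) hg.2.1
        have h2 := codedRat_lt_of_below (abs_sub_approx_rightEnd_le hF hμ _ _) hg.2.2
        refine Set.Subset.trans ?_ (Set.subset_biUnion_of_mem (u := fun σ => atomInterval μ F σ)
          (show σ ∈ S from ⟨m, atom_subset_of_forces hg.1⟩))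
        exact fun x hx => ⟨(h1.trans hx.1).le, hx.2.trans h2⟩
      · simp
    calc volume (codedOpen (e n) ∩ Set.Icc 0 1)
        ≤ volume (⋃ σ ∈ S, atomInterval μ F σ) :=
          measure_mono (Set.inter_subset_left.trans hsub)
      _ = μ (⋃ σ ∈ S, atom F σ) := volume_iUnion_atomInterval hF S
      _ ≤ μ (⋃ m, generatedAlgebra F (f (ψ n) m)) := measure_mono
          (Set.iUnion₂_subset fun σ ⟨m, hm⟩ => hm.trans (Set.subset_iUnion_of_subset m subset_rfl))
      _ ≤ 2⁻¹ ^ n := hmeas n (ψ n) le_rfl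
  · intro ω hω x hx
    refine Set.mem_iInter.2 fun n => ?_
    obtain ⟨m, hm⟩ := Set.mem_iUnion.1 (Set.mem_iInter.1 (hAf hω) (ψ n))
    obtain ⟨N, hN⟩ := exists_forces_address hm
    obtain ⟨q₁, hq1, hq1'⟩ := exists_rat_btwn (hx N).1
    obtain ⟨q₂, hq2, hq2'⟩ := exists_rat_btwn (hx N).2
    obtain ⟨c₁, rfl⟩ := exists_codedRat_eq q₁
    obtain ⟨c₂, rfl⟩ := exists_codedRat_eq q₂
    obtain ⟨k, hk1, hk2⟩ := ((eventually_below_swap (abs_sub_approx_leftEnd_le hF hμ _) hq1).and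
      (eventually_below (abs_sub_approx_rightEnd_le hF hμ _) hq2')).exists
    obtain ⟨j, hj⟩ := (hrange n).superset
      (Set.mem_range_self (m, (c₁, c₂), address F ω N, k))
    refine Set.mem_iUnion.2 ⟨j, ?_⟩
    rw [hj, pushforwardCode, if_pos ⟨hN, hk1, hk2⟩]
    exact ⟨hq1', hq2⟩

theorem isRandom_iff_wcPoint_mem_RAND (hF : ∀ i, MeasurableSet (F i)) (hna : IsNonAtomic μ F)
    (hb : ComputableIn (oracle t) b) (hμ : IsApprox μ F b) (ω : Ω) :
    IsRandom μ t (generatedAlgebra F) ω ↔ ∃ x ∈ wcPoint μ F ω, x ∈ RAND t := by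
  have hpoint : ∀ x, x ∈ wcPoint μ F ω ↔ wcFiber μ F ω = {x} := by
    intro x
    constructor
    · rintro ⟨h, rfl⟩
      exact h.choose_spec
    · intro h
      have h' : ∃ y, wcFiber μ F ω = {y} := ⟨x, h⟩
      exact ⟨h', Set.singleton_injective (h'.choose_spec.symm.trans h)⟩
  have hleft : ∀ {x σ}, x ∈ RAND t → leftEnd μ F σ ≠ x := by
    rintro x σ hx rfl
    rw [← termsVal_leftTerms hF] at hx
    exact termsVal_notMem_RAND hb hμ (sorted_leftTerms σ) hx
  have hright : ∀ {x σ}, x ∈ RAND t → rightEnd μ F σ ≠ x := by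
    rintro x σ hx rfl
    rw [← termsVal_rightTerms hF] at hx
    exact termsVal_notMem_RAND hb hμ (sorted_rightTerms σ) hx
  simp only [hpoint]
  constructor
  · intro hω
    obtain ⟨x, hl, hr, hx⟩ := exists_tendsto_endpoints hF hna ω
    have hxR : x ∈ RAND t := by
      refine ⟨⟨?_, ?_⟩, fun V hV hxV => ?_⟩
      · simpa [address, leftEnd] using (hx 0).1
      · simpa [address, rightEnd, leftEnd, atom] using (hx 0).2
      · obtain ⟨A, hA, h⟩ := exists_isEffectiveNull_of_isMLTest hF hb hμ hV
        exact hω A hA (h ω x hl hr hxV)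
    refine ⟨x, ?_, hxR⟩
    rw [wcFiber_eq hF]
    refine Set.Subset.antisymm (fun y hy => ?_) (Set.singleton_subset_iff.2 (Set.mem_iInter.2
      fun n => ⟨(hx n).1, lt_of_le_of_ne (hx n).2 (hright hxR).symm⟩))
    exact le_antisymm (ge_of_tendsto' hr fun n => (Set.mem_iInter.1 hy n).2.le)
      (le_of_tendsto' hl fun n => (Set.mem_iInter.1 hy n).1)
  · rintro ⟨x, hx, hxR⟩ A hA hωA
    obtain ⟨V, hV, h⟩ := exists_isMLTest_of_isEffectiveNull hF hb hμ hA
    refine hxR.2 V hV (h ω hωA x fun n => ?_)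
    have hxn : x ∈ atomInterval μ F (address F ω n) := by
      have : x ∈ wcFiber μ F ω := hx ▸ Set.mem_singleton x
      rw [wcFiber_eq hF] at this
      exact Set.mem_iInter.1 this n
    exact ⟨lt_of_le_of_ne hxn.1 (hleft hxR), hxn.2⟩

end Tests

end BrownianRandomness

open BrownianRandomness in
theorem mainTheorem3 (W : Measure PathSpace) (hW : IsWienerMeasure W) (t : unitInterval)
    (F : ℕ → Set PathSpace) (hF : IsEffectiveGeneratingSequence W t F) (hna : IsNonAtomic W F)
    (ω : PathSpace) :
    IsRandom W t (generatedAlgebra F) ω ↔ ∃ x ∈ wcPoint W F ω, x ∈ RAND t := by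
  have := hW.isProbabilityMeasure
  obtain ⟨β, hβ, hβW⟩ := hF.approx
  obtain ⟨b, hb, hbW⟩ := exists_isApprox hβ hβW
  exact isRandom_iff_wcPoint_mem_RAND hF.measurableSet hna hb hbW ω
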